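/- Let $\widehat f(w)=\int_{\mathbb R} f(x)e^{-2\pi i wx}\,dx$. A function $\phi\in L^1(\mathbb R)$ is said to be of type II if there are real numbers $b$ and $v_1,v_2,\dots$ with $\sum_j v_j^2<\infty$ such that $$\widehat\phi(w)=e^{-|w|}\,e^{-2\pi i b w}\prod_{j=1}^{\infty}\left(1+2\pi i v_jw\right)^{-1}e^{2\pi i v_jw}\qquad\text{for all } w\in\mathbb R .$$ For $\gamma,h>0$ put $\phi_\gamma(x)=\sqrt{\gamma}\,\phi(\gamma x)$ and $$M_{\phi,h}=\operatorname*{ess\,sup}_{w\in[0,1/h]}\ \frac{\sum_{l\in\mathbb Z}\left(w+\tfrac lh\right)^2\left|\widehat\phi\left(w+\tfrac lh\right)\right|^2}{\sum_{l\in\mathbb Z}\left|\widehat\phi\left(w+\tfrac lh\right)\right|^2}.$$ For $\alpha,\beta>0$ let $\mathcal G(\phi,\alpha,\beta)=\{e^{2\pi i\beta m x}\phi(x-\alpha k): k,m\in\mathbb Z\}$; it is a frame for $L^2(\mathbb R)$ if its members lie in $L^2(\mathbb R)$ and there are constants $A,B>0$ with $A\|f\|^2\le\sum_{k,m\in\mathbb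 Z}|\langle f,e^{2\pi i\beta m\,\cdot}\phi(\cdot-\alpha k)\rangle|^2\le B\|f\|^2$ for all $f\in L^2(\mathbb R)$. **Theorem.** Let $\phi$ be of type II. Then $$\lim_{\gamma\to0^+}M_{\phi_\gamma,1/\alpha}=\frac{\alpha^2}{4}\qquad\text{for every }\alpha>0 .$$ Consequently, if $\alpha,\beta>0$ and $\alpha\beta<1$, then there is a $\gamma>0$ such that $\mathcal G(\phi_\gamma,\alpha,\beta)$ is a frame for $L^2(\mathbb R)$; more precisely, one can take $\gamma=c\beta$ with a constant $c>0$ that depends only on $\phi$ and on the product $\alpha\beta$. -/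

import Mathlib

open MeasureTheory Filter Topology
open scoped ENNReal FourierTransform

noncomputable section

/-- One factor `(1 + 2πi v w)⁻¹ e^{2πi v w}` of the infinite product, as a function of `v w = t`. -/
def schoenbergFactor (t : ℝ) : ℂ :=
  (1 + 2 * Real.pi * t * Complex.I)⁻¹ * Complex.exp (2 * Real.pi * t * Complex.I)

/-- The product `∏_j (1 + 2πi v_j w)⁻¹ e^{2πi v_j w}` converges unconditionally as soon as
`∑ v_j² < ∞`, so the value of `∏'` in `IsTypeII` is the genuine infinite product. -/
theorem multipliable_schoenbergFactor {v : ℕ → ℝ} (hv : Summable fun j => v j ^ 2) (w : ℝ) :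
    Multipliable fun j => schoenbergFactor (v j * w) := by
  have hs : Summable fun j => (2 * Real.pi * w) ^ 2 * v j ^ 2 := hv.mul_left _
  have key : Summable fun j => schoenbergFactor (v j * w) - 1 := by
    refine Summable.of_norm_bounded_eventually_nat hs ?_
    have h1 : ∀ᶠ j in atTop, (2 * Real.pi * w) ^ 2 * v j ^ 2 < 1 :=
      hs.tendsto_atTop_zero.eventually (gt_mem_nhds one_pos)
    filter_upwards [h1] with j hj
    set z : ℂ := 2 * Real.pi * ((v j * w : ℝ) : ℂ) * Complex.I with hz
    have hz' : z = ((2 * Real.pi * (v j * w) : ℝ) : ℂ) * Complex.I := by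
      rw [hz]; push_cast; ring
    have hn : ‖z‖ ^ 2 = (2 * Real.pi * w) ^ 2 * v j ^ 2 := by
      rw [hz', norm_mul, Complex.norm_I, mul_one, Complex.norm_real, Real.norm_eq_abs, sq_abs]
      ring
    have hle : ‖z‖ ≤ 1 := by
      rw [← hn] at hj
      nlinarith [norm_nonneg z]
    have hone : 1 ≤ ‖1 + z‖ := by
      have h := Complex.abs_re_le_norm (1 + z)
      rw [hz'] at h ⊢
      simpa using h
    have hne : (1 : ℂ) + z ≠ 0 := by
      intro h
      rw [h, norm_zero] at hone
      linarith
    have heq : schoenbergFactor (v j * w) - 1 = (1 + z)⁻¹ * (Complex.exp z - 1 - z) := by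
      unfold schoenbergFactor
      rw [← hz]
      field_simp
      ring
    rw [heq, norm_mul, norm_inv, ← hn]
    calc ‖1 + z‖⁻¹ * ‖Complex.exp z - 1 - z‖ ≤ 1 * ‖z‖ ^ 2 := by
          gcongr
          · exact inv_le_one_of_one_le₀ hone
          · exact Complex.norm_exp_sub_one_sub_id_le hle
      _ = ‖z‖ ^ 2 := one_mul _
  simpa using multipliable_one_add_of_summable key.norm

/-- Functions of type II: `φ ∈ L¹(ℝ)` whose Fourier transform is
`e^{-|w|} e^{-2πi c w} ∏_j (1 + 2πi v_j w)⁻¹ e^{2πi v_j w}` with real `c`, `v_j` and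
`∑ v_j² < ∞`. Finite products are the case where almost all `v_j` vanish. -/
def IsTypeII (φ : ℝ → ℂ) : Prop :=
  Integrable φ ∧ ∃ (c : ℝ) (v : ℕ → ℝ), (Summable fun j => v j ^ 2) ∧
    ∀ w : ℝ, 𝓕 φ w = Real.exp (-|w|) * Complex.exp (-(2 * Real.pi * c * w * Complex.I)) *
      ∏' j, schoenbergFactor (v j * w)

/-- The dilate `φ_γ(x) = √γ φ(γ x)`. -/
def dilate (φ : ℝ → ℂ) (γ : ℝ) : ℝ → ℂ := fun x => Real.sqrt γ * φ (γ * x)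

/-- `B_{φ,h}(w) = ∑_l (w + l/h)² |φ̂(w + l/h)|² / ∑_l |φ̂(w + l/h)|²`, with values in `[0, ∞]`. -/
def bernsteinB (φ : ℝ → ℂ) (h w : ℝ) : ℝ≥0∞ :=
  (∑' l : ℤ, ENNReal.ofReal ((w + l / h) ^ 2 * ‖𝓕 φ (w + l / h)‖ ^ 2)) /
    ∑' l : ℤ, ENNReal.ofReal (‖𝓕 φ (w + l / h)‖ ^ 2)

/-- `M_{φ,h}`, the essential supremum of `B_{φ,h}` over `[0, 1/h]`, with values in `[0, ∞]`. -/
def bernsteinM (φ : ℝ → ℂ) (h : ℝ) : ℝ≥0∞ :=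
  essSup (bernsteinB φ h) (volume.restrict (Set.Icc 0 (1 / h)))

/-- A family in a complex inner product space is a frame if
`A ‖f‖² ≤ ∑ |⟨f, e_i⟩|² ≤ B ‖f‖²` for all `f`, for some constants `A, B > 0`. -/
def IsHilbertFrame {ι H : Type*} [NormedAddCommGroup H] [InnerProductSpace ℂ H]
    (e : ι → H) : Prop :=
  ∃ A B : ℝ, 0 < A ∧ 0 < B ∧ ∀ f : H, (Summable fun i => ‖inner ℂ (e i) f‖ ^ 2) ∧
    A * ‖f‖ ^ 2 ≤ ∑' i, ‖inner ℂ (e i) f‖ ^ 2 ∧ ∑' i, ‖inner ℂ (e i) f‖ ^ 2 ≤ B * ‖f‖ ^ 2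

/-- The time-frequency shift `x ↦ e^{2πi β m x} φ(x - α k)`, with `p = (k, m)`. -/
def gaborAtom (φ : ℝ → ℂ) (α β : ℝ) (p : ℤ × ℤ) : ℝ → ℂ := fun x =>
  Complex.exp (2 * Real.pi * β * p.2 * x * Complex.I) * φ (x - α * p.1)

/-- The Gabor system `𝒢(φ, α, β)` consists of functions in `L²(ℝ)` and is a frame for `L²(ℝ)`. -/
def IsGaborFrame (φ : ℝ → ℂ) (α β : ℝ) : Prop :=
  ∃ h : ∀ p : ℤ × ℤ, MemLp (gaborAtom φ α β p) 2 volume,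
    IsHilbertFrame fun p => (h p).toLp (gaborAtom φ α β p)

end

/-!
The squared modulus of a factor `(1 + 2πi v w)⁻¹ e^{2πi v w}` is `(1 + (2π v w)²)⁻¹`, which decreases
in `|w|`. So the transform `G` of `φ_γ` has no zeros, `|G|` is even, and `|G|` falls at least
as fast as `e^{-|w|/γ}` between any two points (`HasExpDecay`). Both claims follow from this alone.

The quotient `B(w)` is a mean of the numbers `(w + lα)²` with weights `|G(w + lα)|²`. If `x` is the
point of `w + αℤ` nearest to the origin, every other point `y` carries a weight smaller by the
factor `e^{-2(|y| - |x|)/γ}`, and `t e^{-t} ≤ 1`, `t² e^{-t} ≤ 2` show that its contribution exceeds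
`α²/4` by `O(γ)` only (`exists_tsum_sq_mul_norm_sq_le`). Conversely, near `w = α / 2` no point of
`w + αℤ` is much closer to the origin than `α / 2` (`ofReal_le_bernsteinM`).

For the frame property put `T = 1 / α`, so that `β < T`. By Plancherel, periodization and
Parseval's identity on `(0, T]`, the sum of the squared Gabor coefficients of `f` is
`T ∫₀ᵀ ∑_m |∑_n conj (G (w + nT - βm)) f̂(w + nT)|² dw` (`tsum_sq_inner_gaborAtom`), while
`‖f‖² = ∫₀ᵀ ∑_n |f̂(w + nT)|² dw`. It remains to bound the matrices `G(w + nT - βm)` from above and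
below on `ℓ²`, uniformly in `w`. The upper bound is Schur's test. For the lower bound keep, for each
`n`, only the row `m` with `βm` nearest to `w + nT`; these rows are distinct because `β < T`. In such
a row `|w + nT - βm| ≤ β / 2`, and `w + n'T` is farther from `βm` by at least `|n' - n| (T - β)`,
so that the entries decay by the factor `e^{-(T - β)/γ}` at each step away from column `n`. For
`γ = cβ` with `c = (1 / (αβ) - 1) / 2` this factor is `e^{-2} < 1 / 5`, and the rows form a
diagonally dominant matrix (`tsum_sq_le_tsum_sq_tsum`).

The atoms are only known to be integrable with square-integrable Fourier transform; that they are
in `L²(ℝ)` and that their `L²` Fourier transform is the classical one is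
`memLp_two_of_fourier` and `fourier_toLp_eq`.
-/

open MeasureTheory Filter Topology
open scoped ENNReal FourierTransform

noncomputable section

/-! ### The Fourier transform of a type II function -/

theorem norm_schoenbergFactor (t : ℝ) :
    ‖schoenbergFactor t‖ = (Real.sqrt (1 + (2 * Real.pi * t) ^ 2))⁻¹ := by
  have h1 : (2 * Real.pi * t * Complex.I : ℂ) = ((2 * Real.pi * t : ℝ) : ℂ) * Complex.I := by
    push_cast; ring
  rw [schoenbergFactor, h1, norm_mul, norm_inv, Complex.norm_exp_ofReal_mul_I, mul_one]
  congr 1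
  rw [← Complex.ofReal_one, Complex.norm_add_mul_I]
  simp

theorem norm_schoenbergFactor_le_of_abs_le {s t : ℝ} (h : |s| ≤ |t|) :
    ‖schoenbergFactor t‖ ≤ ‖schoenbergFactor s‖ := by
  have h2 : s ^ 2 ≤ t ^ 2 := sq_le_sq.mpr h
  rw [norm_schoenbergFactor, norm_schoenbergFactor]
  gcongr ?_⁻¹
  apply Real.sqrt_le_sqrt
  simp only [mul_pow]
  gcongr

theorem exp_neg_sq_le_norm_schoenbergFactor (t : ℝ) :
    Real.exp (-(2 * Real.pi * t) ^ 2) ≤ ‖schoenbergFactor t‖ := by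
  rw [norm_schoenbergFactor, Real.exp_neg]
  gcongr ?_⁻¹
  refine (Real.sqrt_le_iff.mpr ⟨by positivity, ?_⟩ : _ ≤ 1 + (2 * Real.pi * t) ^ 2).trans ?_
  · nlinarith [sq_nonneg (2 * Real.pi * t)]
  · linarith [Real.add_one_le_exp ((2 * Real.pi * t) ^ 2)]

/-- `G` is continuous, has no zeros, and `e^{|x|/τ} |G(x)|` is a nonincreasing function of `|x|`.
In particular `|G|` is even. -/
structure HasExpDecay (τ : ℝ) (G : ℝ → ℂ) : Prop where
  continuous : Continuous G
  ne_zero : ∀ x, G x ≠ 0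
  norm_le : ∀ x y, |x| ≤ |y| → ‖G y‖ ≤ Real.exp ((|x| - |y|) / τ) * ‖G x‖

theorem continuous_fourier_of_integrable {f : ℝ → ℂ} (hf : Integrable f) : Continuous (𝓕 f) :=
  VectorFourier.fourierIntegral_continuous Real.continuous_fourierChar
    (by fun_prop) hf

/-- The moduli of the partial products are at least `exp (-∑ (2π v_j w)²) > 0`. -/
theorem tprod_schoenbergFactor_ne_zero {v : ℕ → ℝ} (hv : Summable fun j => v j ^ 2) (w : ℝ) :
    ∏' j, schoenbergFactor (v j * w) ≠ 0 := by
  have hp := (multipliable_schoenbergFactor hv w).hasProd.norm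
  have hs : Summable fun j => (2 * Real.pi * (v j * w)) ^ 2 := by
    convert! hv.mul_left ((2 * Real.pi * w) ^ 2) using 2
    ring
  rw [← norm_pos_iff]
  refine (Real.exp_pos (-∑' j, (2 * Real.pi * (v j * w)) ^ 2)).trans_le ?_
  refine ge_of_tendsto' hp fun s => ?_
  calc Real.exp (-∑' j, (2 * Real.pi * (v j * w)) ^ 2)
      ≤ Real.exp (-∑ j ∈ s, (2 * Real.pi * (v j * w)) ^ 2) := by
        gcongr
        exact hs.sum_le_tsum s fun j _ => sq_nonneg _
    _ = ∏ j ∈ s, Real.exp (-(2 * Real.pi * (v j * w)) ^ 2) := by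
        rw [← Finset.sum_neg_distrib, Real.exp_sum]
    _ ≤ ∏ j ∈ s, ‖schoenbergFactor (v j * w)‖ :=
        Finset.prod_le_prod (fun j _ => (Real.exp_pos _).le) fun j _ =>
          exp_neg_sq_le_norm_schoenbergFactor _

theorem norm_tprod_schoenbergFactor_le {v : ℕ → ℝ} (hv : Summable fun j => v j ^ 2)
    {x y : ℝ} (h : |x| ≤ |y|) :
    ‖∏' j, schoenbergFactor (v j * y)‖ ≤ ‖∏' j, schoenbergFactor (v j * x)‖ := by
  refine le_of_tendsto_of_tendsto' (multipliable_schoenbergFactor hv y).hasProd.norm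
    (multipliable_schoenbergFactor hv x).hasProd.norm fun s => ?_
  refine Finset.prod_le_prod (fun j _ => norm_nonneg _) fun j _ => ?_
  apply norm_schoenbergFactor_le_of_abs_le
  rw [abs_mul, abs_mul]
  gcongr

/-- Each factor of the product has modulus `(1 + (2π v_j w)²)^{-1/2}`, which decreases in `|w|`, so
that `|φ̂(w)|` decreases at least as fast as `e^{-|w|}`. -/
theorem IsTypeII.hasExpDecay_fourier {φ : ℝ → ℂ} (hφ : IsTypeII φ) : HasExpDecay 1 (𝓕 φ) := by
  obtain ⟨hint, c, v, hv, hw⟩ := hφ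
  have hn : ∀ w : ℝ, ‖𝓕 φ w‖ = Real.exp (-|w|) * ‖∏' j, schoenbergFactor (v j * w)‖ := by
    intro w
    have h1 : (-(2 * Real.pi * c * w * Complex.I) : ℂ) =
        ((-(2 * Real.pi * c * w) : ℝ) : ℂ) * Complex.I := by push_cast; ring
    rw [hw, norm_mul, norm_mul, h1, Complex.norm_exp_ofReal_mul_I, mul_one, Complex.norm_real,
      Real.norm_eq_abs, Real.abs_exp]
  refine ⟨continuous_fourier_of_integrable hint, fun x => ?_, fun x y hxy => ?_⟩
  · rw [← norm_pos_iff, hn]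
    exact mul_pos (Real.exp_pos _) (norm_pos_iff.mpr (tprod_schoenbergFactor_ne_zero hv x))
  · rw [hn, hn, ← mul_assoc, ← Real.exp_add]
    have : (|x| - |y|) / 1 + -|x| = -|y| := by ring
    rw [this]
    exact mul_le_mul_of_nonneg_left (norm_tprod_schoenbergFactor_le hv hxy) (Real.exp_pos _).le

theorem integrable_dilate {φ : ℝ → ℂ} (hφ : Integrable φ) {γ : ℝ} (hγ : 0 < γ) :
    Integrable (dilate φ γ) :=
  (hφ.comp_mul_left' hγ.ne').const_mul _

theorem fourier_dilate (φ : ℝ → ℂ) {γ : ℝ} (hγ : 0 < γ) (w : ℝ) :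
    𝓕 (dilate φ γ) w = ((Real.sqrt γ * γ⁻¹ : ℝ) : ℂ) * 𝓕 φ (w / γ) := by
  rw [Real.fourier_real_eq_integral_exp_smul, Real.fourier_real_eq_integral_exp_smul]
  have h := Measure.integral_comp_mul_left
    (fun x : ℝ => Complex.exp (↑(-2 * Real.pi * x * (w / γ)) * Complex.I) • φ x) γ
  rw [abs_of_pos (inv_pos.mpr hγ), Complex.real_smul] at h
  rw [Complex.ofReal_mul, mul_assoc, ← h, ← integral_const_mul]
  congr 1
  ext x
  have : -2 * Real.pi * (γ * x) * (w / γ) = -2 * Real.pi * x * w := by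
    field_simp
  rw [this, dilate, smul_eq_mul, smul_eq_mul]
  ring

theorem IsTypeII.hasExpDecay_fourier_dilate {φ : ℝ → ℂ} (hφ : IsTypeII φ) {γ : ℝ} (hγ : 0 < γ) :
    HasExpDecay γ (𝓕 (dilate φ γ)) := by
  have h := hφ.hasExpDecay_fourier
  refine ⟨continuous_fourier_of_integrable (integrable_dilate hφ.1 hγ), fun x => ?_,
    fun x y hxy => ?_⟩
  · rw [fourier_dilate φ hγ]
    exact mul_ne_zero (Complex.ofReal_ne_zero.mpr (by positivity)) (h.ne_zero _)
  · rw [fourier_dilate φ hγ, fourier_dilate φ hγ, norm_mul, norm_mul, mul_left_comm]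
    gcongr
    have := h.norm_le (x / γ) (y / γ) (by
      rw [abs_div, abs_div]; gcongr)
    rwa [abs_div, abs_div, abs_of_pos hγ, div_one, ← sub_div] at this

/-! ### Exponentially decaying functions sampled on a progression -/

theorem exists_abs_add_mul_le {s : ℝ} (hs : 0 < s) (x : ℝ) :
    ∃ k : ℤ, |x + k * s| ≤ s / 2 := by
  refine ⟨-round (x / s), ?_⟩
  have h := abs_sub_round (x / s)
  have h2 : x + ((-round (x / s) : ℤ) : ℝ) * s = (x / s - round (x / s)) * s := by
    push_cast; field_simp; ring
  rw [h2, abs_mul, abs_of_pos hs]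
  nlinarith

/-- If `k` is such that `x + k s` is near the origin, this bounds the other `|x + j s|` from
below. -/
theorem abs_sub_mul_sub_abs_le_abs {s x : ℝ} (hs : 0 < s) (k j : ℤ) :
    |((j - k : ℤ) : ℝ)| * s - |x + k * s| ≤ |x + j * s| := by
  have h : ((j - k : ℤ) : ℝ) * s = (x + j * s) - (x + k * s) := by push_cast; ring
  have h2 := abs_sub (x + j * s) (x + k * s)
  rw [← h, abs_mul, abs_of_pos hs] at h2
  linarith

theorem summable_exp_neg_mul_abs_int {a : ℝ} (ha : 0 < a) :
    Summable fun j : ℤ => Real.exp (-(|(j : ℝ)| * a)) := by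
  have h : Summable fun n : ℕ => Real.exp (-((n : ℝ) * a)) := by
    have := Real.summable_exp_nat_mul_iff.mpr (neg_neg_of_pos ha)
    simpa using this
  refine Summable.of_nat_of_neg ?_ ?_ <;> simpa using h

theorem tsum_int_sub_right (f : ℤ → ℝ≥0∞) (k : ℤ) : ∑' j, f (j - k) = ∑' j, f j :=
  (Equiv.subRight k).tsum_eq f

theorem HasExpDecay.norm_le_zero {τ : ℝ} {G : ℝ → ℂ} (hG : HasExpDecay τ G) (y : ℝ) :
    ‖G y‖ ≤ Real.exp (-|y| / τ) * ‖G 0‖ := by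
  simpa using hG.norm_le 0 y (by simp)

/-- The bound is uniform in `x`, since `x` may be replaced by the point of `x + sℤ` nearest to the
origin. -/
theorem HasExpDecay.exists_tsum_le {τ : ℝ} {G : ℝ → ℂ} (hτ : 0 < τ) (hG : HasExpDecay τ G)
    {s : ℝ} (hs : 0 < s) :
    ∃ C : ℝ≥0∞, C ≠ ∞ ∧ ∀ x : ℝ, ∑' j : ℤ, ‖G (x + j * s)‖ₑ ≤ C := by
  set f : ℤ → ℝ := fun j => Real.exp (-(|(j : ℝ)| * (s / τ))) with hf
  have hfs : Summable f := summable_exp_neg_mul_abs_int (div_pos hs hτ)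
  refine ⟨ENNReal.ofReal (Real.exp (s / 2 / τ) * ‖G 0‖) * ∑' j, ENNReal.ofReal (f j), ?_,
    fun x => ?_⟩
  · exact ENNReal.mul_ne_top ENNReal.ofReal_ne_top hfs.tsum_ofReal_ne_top
  · obtain ⟨k, hk⟩ := exists_abs_add_mul_le hs x
    rw [← tsum_int_sub_right (fun j => ENNReal.ofReal (f j)) k, ← ENNReal.tsum_mul_left]
    refine ENNReal.tsum_le_tsum fun j => ?_
    rw [← ofReal_norm, ← ENNReal.ofReal_mul (by positivity)]
    apply ENNReal.ofReal_le_ofReal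
    refine (hG.norm_le_zero _).trans ?_
    rw [mul_right_comm, ← Real.exp_add]
    gcongr
    have h := abs_sub_mul_sub_abs_le_abs (x := x) hs k j
    rw [mul_div_assoc', ← neg_div, ← add_div]
    gcongr
    linarith

/-! ### The asymptotics of the Bernstein constant -/

/-- If `|x| ≤ α / 2`, the excess of `y² |G(y)|²` over `α² / 4 |G(y)|²` is of order `τ |G(x)|²`, with
a factor that decays exponentially in `|y| - |x|`. -/
theorem HasExpDecay.sq_mul_norm_sq_le {α τ : ℝ} (hτ : 0 < τ) {G : ℝ → ℂ}
    (hG : HasExpDecay τ G) {x y : ℝ} (hx : |x| ≤ α / 2) (hxy : |x| ≤ |y|) :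
    y ^ 2 * ‖G y‖ ^ 2 ≤ α ^ 2 / 4 * ‖G y‖ ^ 2 +
      (α * τ + 2 * τ ^ 2) * Real.exp (-(|y| - |x|) / τ) * ‖G x‖ ^ 2 := by
  obtain ⟨t, ht⟩ : ∃ t, t = (|y| - |x|) / τ := ⟨_, rfl⟩
  have ht0 : 0 ≤ t := ht ▸ div_nonneg (sub_nonneg.mpr hxy) hτ.le
  have hd : |y| - |x| = τ * t := by rw [ht]; field_simp
  have hα : 0 ≤ α := by linarith [abs_nonneg x]
  have hE : 0 < Real.exp (-t) := Real.exp_pos _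
  have hEE : Real.exp (-t) * Real.exp t = 1 := by rw [← Real.exp_add]; simp
  have h1 : t * Real.exp (-t) ≤ 1 := by
    nlinarith [Real.add_one_le_exp t]
  have h2 : t ^ 2 * Real.exp (-t) ≤ 2 := by
    nlinarith [Real.quadratic_le_exp_of_nonneg ht0]
  -- `y² = (|x| + τ t)²` with `|x| ≤ α / 2`
  have hy : y ^ 2 ≤ α ^ 2 / 4 + (α * (τ * t) + (τ * t) ^ 2) := by
    rw [← sq_abs y, show |y| = |x| + τ * t by linarith]
    nlinarith [abs_nonneg x, mul_nonneg hτ.le ht0]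
  have hGy : ‖G y‖ ^ 2 ≤ (Real.exp (-t) * ‖G x‖) ^ 2 := by
    have h := hG.norm_le x y hxy
    rw [← neg_sub, neg_div, ← ht] at h
    gcongr
  rw [neg_div, ← ht]
  calc y ^ 2 * ‖G y‖ ^ 2
      ≤ (α ^ 2 / 4 + (α * (τ * t) + (τ * t) ^ 2)) * ‖G y‖ ^ 2 := by gcongr
    _ = α ^ 2 / 4 * ‖G y‖ ^ 2 + (α * (τ * t) + (τ * t) ^ 2) * ‖G y‖ ^ 2 := by ring
    _ ≤ α ^ 2 / 4 * ‖G y‖ ^ 2 +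
        (α * (τ * t) + (τ * t) ^ 2) * (Real.exp (-t) * ‖G x‖) ^ 2 := by gcongr
    _ = α ^ 2 / 4 * ‖G y‖ ^ 2 + (α * τ * (t * Real.exp (-t)) + τ ^ 2 * (t ^ 2 * Real.exp (-t))) *
        Real.exp (-t) * ‖G x‖ ^ 2 := by ring
    _ ≤ α ^ 2 / 4 * ‖G y‖ ^ 2 + (α * τ * 1 + τ ^ 2 * 2) * Real.exp (-t) * ‖G x‖ ^ 2 := by gcongr
    _ = _ := by ring

/-- Since `C` is independent of `τ` and `G`, the quotient of the two sums is at most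
`α² / 4 + O(τ)`. -/
theorem exists_tsum_sq_mul_norm_sq_le {α : ℝ} (hα : 0 < α) :
    ∃ C : ℝ≥0∞, C ≠ ∞ ∧ ∀ (τ : ℝ) (G : ℝ → ℂ), 0 < τ → τ ≤ α → HasExpDecay τ G → ∀ w : ℝ,
      ∑' l : ℤ, ENNReal.ofReal ((w + l * α) ^ 2 * ‖G (w + l * α)‖ ^ 2) ≤
        (ENNReal.ofReal (α ^ 2 / 4) + ENNReal.ofReal (α * τ + 2 * τ ^ 2) * C) *
          ∑' l : ℤ, ENNReal.ofReal (‖G (w + l * α)‖ ^ 2) := by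
  set f : ℤ → ℝ := fun j => Real.exp (1 - |(j : ℝ)|) with hf
  have hfs : Summable f := by
    have := (summable_exp_neg_mul_abs_int one_pos).mul_left (Real.exp 1)
    refine this.congr fun j => ?_
    simp only [hf]
    rw [← Real.exp_add, mul_one, sub_eq_add_neg]
  refine ⟨∑' j, ENNReal.ofReal (f j), hfs.tsum_ofReal_ne_top, ?_⟩
  intro τ G hτ hτα hG w
  obtain ⟨k, hk⟩ := exists_abs_add_mul_le hα w
  have key : ∀ l : ℤ, (w + l * α) ^ 2 * ‖G (w + l * α)‖ ^ 2 ≤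
      α ^ 2 / 4 * ‖G (w + l * α)‖ ^ 2 +
        (α * τ + 2 * τ ^ 2) * f (l - k) * ‖G (w + k * α)‖ ^ 2 := by
    intro l
    -- for `l = k` the first summand suffices; otherwise `|l - k| ≥ 1` and `τ ≤ α` give
    -- `(|w + l α| - |w + k α|) / τ ≥ |l - k| - 1`
    rcases eq_or_ne l k with rfl | hlk
    · have : (w + l * α) ^ 2 ≤ α ^ 2 / 4 := by
        rw [← sq_abs]; nlinarith [abs_nonneg (w + l * α)]
      have h2 : 0 ≤ (α * τ + 2 * τ ^ 2) * f (l - l) * ‖G (w + l * α)‖ ^ 2 := by positivity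
      nlinarith [mul_le_mul_of_nonneg_right this (sq_nonneg ‖G (w + l * α)‖)]
    · have hj : (1 : ℝ) ≤ |((l - k : ℤ) : ℝ)| := by
        exact_mod_cast Int.one_le_abs (sub_ne_zero.mpr hlk)
      have hd := abs_sub_mul_sub_abs_le_abs (x := w) hα k l
      have hle : |w + k * α| ≤ |w + l * α| := by nlinarith
      refine (hG.sq_mul_norm_sq_le hτ hk hle).trans ?_
      gcongr
      refine Real.exp_le_exp.mpr ?_
      rw [div_le_iff₀ hτ]
      nlinarith
  calc ∑' l : ℤ, ENNReal.ofReal ((w + l * α) ^ 2 * ‖G (w + l * α)‖ ^ 2)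
      ≤ ∑' l : ℤ, (ENNReal.ofReal (α ^ 2 / 4) * ENNReal.ofReal (‖G (w + l * α)‖ ^ 2) +
          ENNReal.ofReal (α * τ + 2 * τ ^ 2) * ENNReal.ofReal (‖G (w + k * α)‖ ^ 2) *
            ENNReal.ofReal (f (l - k))) := by
        refine ENNReal.tsum_le_tsum fun l => (ENNReal.ofReal_le_ofReal (key l)).trans ?_
        rw [ENNReal.ofReal_add (by positivity) (by positivity), ENNReal.ofReal_mul (by positivity),
          ENNReal.ofReal_mul (by positivity), ENNReal.ofReal_mul (by positivity), mul_right_comm]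
    _ = ENNReal.ofReal (α ^ 2 / 4) * ∑' l : ℤ, ENNReal.ofReal (‖G (w + l * α)‖ ^ 2) +
          ENNReal.ofReal (α * τ + 2 * τ ^ 2) * ENNReal.ofReal (‖G (w + k * α)‖ ^ 2) *
            ∑' j, ENNReal.ofReal (f j) := by
        rw [ENNReal.tsum_add, ENNReal.tsum_mul_left, ENNReal.tsum_mul_left,
          tsum_int_sub_right (fun j => ENNReal.ofReal (f j)) k]
    _ ≤ ENNReal.ofReal (α ^ 2 / 4) * ∑' l : ℤ, ENNReal.ofReal (‖G (w + l * α)‖ ^ 2) +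
          ENNReal.ofReal (α * τ + 2 * τ ^ 2) *
            (∑' l : ℤ, ENNReal.ofReal (‖G (w + l * α)‖ ^ 2)) * ∑' j, ENNReal.ofReal (f j) := by
        gcongr
        exact ENNReal.le_tsum (f := fun l : ℤ => ENNReal.ofReal (‖G (w + l * α)‖ ^ 2)) k
    _ = _ := by ring

theorem HasExpDecay.tsum_norm_sq_ne_top {τ : ℝ} {G : ℝ → ℂ} (hτ : 0 < τ) (hG : HasExpDecay τ G)
    {s : ℝ} (hs : 0 < s) (w : ℝ) :
    ∑' l : ℤ, ENNReal.ofReal (‖G (w + l * s)‖ ^ 2) ≠ ∞ := by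
  obtain ⟨C, hC, h⟩ := hG.exists_tsum_le hτ hs
  have hle : ∑' l : ℤ, ENNReal.ofReal (‖G (w + l * s)‖ ^ 2) ≤ ENNReal.ofReal ‖G 0‖ * C := by
    refine le_trans ?_ (mul_le_mul_right (h w) _)
    rw [← ENNReal.tsum_mul_left]
    refine ENNReal.tsum_le_tsum fun l => ?_
    rw [← ofReal_norm, ← ENNReal.ofReal_mul (norm_nonneg _), sq]
    gcongr
    simpa using hG.norm_le_zero (w + l * s) |>.trans
      (mul_le_of_le_one_left (norm_nonneg _) (Real.exp_le_one_iff.mpr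
        (div_nonpos_of_nonpos_of_nonneg (neg_nonpos.mpr (abs_nonneg _)) hτ.le)))
  exact ne_top_of_le_ne_top (ENNReal.mul_ne_top ENNReal.ofReal_ne_top hC) hle

theorem bernsteinB_one_div (φ : ℝ → ℂ) (α w : ℝ) :
    bernsteinB φ (1 / α) w =
      (∑' l : ℤ, ENNReal.ofReal ((w + l * α) ^ 2 * ‖𝓕 φ (w + l * α)‖ ^ 2)) /
        ∑' l : ℤ, ENNReal.ofReal (‖𝓕 φ (w + l * α)‖ ^ 2) := by
  simp only [bernsteinB, div_div_eq_mul_div, div_one]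

/-- `B_{φ,1/α}(w)` is a weighted mean of the numbers `(w + l α)²`, none of which is less than `r²`
when `w` has distance at least `r` from `αℤ`. -/
theorem ofReal_sq_le_bernsteinB {φ : ℝ → ℂ} {τ α r w : ℝ} (hτ : 0 < τ) (hα : 0 < α)
    (hφ : HasExpDecay τ (𝓕 φ)) (hr : 0 ≤ r) (h1 : r ≤ w) (h2 : w ≤ α - r) :
    ENNReal.ofReal (r ^ 2) ≤ bernsteinB φ (1 / α) w := by
  rw [bernsteinB_one_div, ENNReal.le_div_iff_mul_le (Or.inl ?_)
    (Or.inl (hφ.tsum_norm_sq_ne_top hτ hα w)), ← ENNReal.tsum_mul_left]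
  · refine ENNReal.tsum_le_tsum fun l => ?_
    rw [← ENNReal.ofReal_mul (sq_nonneg _)]
    refine ENNReal.ofReal_le_ofReal (mul_le_mul_of_nonneg_right ?_ (sq_nonneg _))
    rcases le_or_gt 0 l with hl | hl
    · have : (0 : ℝ) ≤ l := by exact_mod_cast hl
      nlinarith [mul_nonneg this hα.le]
    · have : (l : ℝ) ≤ -1 := by exact_mod_cast Int.le_sub_one_of_lt hl
      nlinarith [mul_le_mul_of_nonneg_right this hα.le]
  · intro h
    have h0 := ENNReal.tsum_eq_zero.mp h 0
    rw [ENNReal.ofReal_eq_zero] at h0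
    have := norm_pos_iff.mpr (hφ.ne_zero (w + (0 : ℤ) * α))
    exact absurd h0 (not_le.mpr (by positivity))

theorem ofReal_le_bernsteinM {φ : ℝ → ℂ} {τ α : ℝ} (hτ : 0 < τ) (hα : 0 < α)
    (hφ : HasExpDecay τ (𝓕 φ)) : ENNReal.ofReal (α ^ 2 / 4) ≤ bernsteinM φ (1 / α) := by
  have key : ∀ r ∈ Set.Ioo 0 (α / 2), ENNReal.ofReal (r ^ 2) ≤ bernsteinM φ (1 / α) := by
    intro r hr
    by_contra! hlt
    have hae := ae_lt_of_essSup_lt hlt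
    rw [ae_restrict_iff' measurableSet_Icc, one_div_one_div] at hae
    have hnull : volume (Set.Icc r (α - r)) = 0 := by
      refine measure_mono_null (fun w hw => ?_) hae
      simp only [Set.mem_compl_iff, Set.mem_ofPred_eq, not_forall, not_lt]
      exact ⟨⟨hr.1.le.trans hw.1, by linarith [hw.2, hr.1]⟩,
        ofReal_sq_le_bernsteinB hτ hα hφ hr.1.le hw.1 hw.2⟩
    rw [Real.volume_Icc, ENNReal.ofReal_eq_zero] at hnull
    linarith [hr.2]
  have hlim : Tendsto (fun r : ℝ => ENNReal.ofReal (r ^ 2)) (𝓝[<] (α / 2))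
      (𝓝 (ENNReal.ofReal ((α / 2) ^ 2))) :=
    (ENNReal.tendsto_ofReal ((continuous_pow 2).tendsto _)).mono_left nhdsWithin_le_nhds
  rw [show α ^ 2 / 4 = (α / 2) ^ 2 by ring]
  exact le_of_tendsto hlim (Filter.eventually_of_mem (Ioo_mem_nhdsLT (by positivity)) key)

theorem tendsto_bernsteinM {φ : ℝ → ℂ} (hφ : IsTypeII φ) {α : ℝ} (hα : 0 < α) :
    Tendsto (fun γ : ℝ => bernsteinM (dilate φ γ) (1 / α)) (𝓝[>] 0)
      (𝓝 (ENNReal.ofReal (α ^ 2 / 4))) := by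
  obtain ⟨C, hC, h⟩ := exists_tsum_sq_mul_norm_sq_le hα
  have hlim : Tendsto (fun γ : ℝ => ENNReal.ofReal (α ^ 2 / 4) +
      ENNReal.ofReal (α * γ + 2 * γ ^ 2) * C) (𝓝[>] 0) (𝓝 (ENNReal.ofReal (α ^ 2 / 4))) := by
    have h1 : Tendsto (fun γ : ℝ => ENNReal.ofReal (α * γ + 2 * γ ^ 2)) (𝓝[>] 0) (𝓝 0) := by
      have : Continuous fun γ : ℝ => ENNReal.ofReal (α * γ + 2 * γ ^ 2) :=
        ENNReal.continuous_ofReal.comp (by fun_prop)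
      simpa using (this.tendsto 0).mono_left nhdsWithin_le_nhds
    simpa using (ENNReal.Tendsto.mul_const h1 (Or.inr hC)).const_add (ENNReal.ofReal (α ^ 2 / 4))
  refine tendsto_of_tendsto_of_tendsto_of_le_of_le' tendsto_const_nhds hlim ?_ ?_
  · filter_upwards [self_mem_nhdsWithin] with γ hγ
    exact ofReal_le_bernsteinM hγ hα (hφ.hasExpDecay_fourier_dilate hγ)
  · filter_upwards [Ioc_mem_nhdsGT hα] with γ hγ
    refine essSup_le_of_ae_le _ (Eventually.of_forall fun w => ?_)
    rw [bernsteinB_one_div]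
    exact ENNReal.div_le_of_le_mul
      (h γ _ hγ.1 hγ.2 (hφ.hasExpDecay_fourier_dilate hγ.1) w)

open scoped SchwartzMap

/-! ### Integrable functions with square-integrable Fourier transform -/

theorem integral_mul_fourier_schwartz {f : ℝ → ℂ} (hf : Integrable f) (u : 𝓢(ℝ, ℂ)) :
    ∫ x, u x • f x = ∫ w, (𝓕⁻ u) w • 𝓕 f w := by
  have h := VectorFourier.integral_fourierIntegral_smul_eq_flip (L := innerₗ ℝ)
    (f := (𝓕⁻ u : 𝓢(ℝ, ℂ))) (g := f) Real.continuous_fourierChar (by fun_prop)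
    ((𝓕⁻ u : 𝓢(ℝ, ℂ)).integrable (μ := volume)) hf
  rw [flip_innerₗ] at h
  have h2 : (𝓕 (𝓕⁻ u : 𝓢(ℝ, ℂ)) : 𝓢(ℝ, ℂ)) = u := FourierTransform.fourier_fourierInv_eq u
  have h3 : 𝓕 ((𝓕⁻ u : 𝓢(ℝ, ℂ)) : ℝ → ℂ) = u := by
    rw [← SchwartzMap.fourier_coe, h2]
  rw [← h3]
  exact h

/-- Both `f` and the `L²` inverse Fourier transform of `𝓕 f` have the same pairing with every test
function. -/
theorem ae_eq_fourierInv_toLp {f : ℝ → ℂ} (hf : Integrable f) (hF : MemLp (𝓕 f) 2 volume) :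
    f =ᵐ[volume] (𝓕⁻ (hF.toLp (𝓕 f)) : Lp ℂ 2 (volume : Measure ℝ)) := by
  set Q : Lp ℂ 2 (volume : Measure ℝ) := 𝓕⁻ (hF.toLp (𝓕 f)) with hQ
  refine ae_eq_of_integral_contDiff_smul_eq hf.locallyIntegrable
    ((Lp.memLp Q).locallyIntegrable (by norm_num)) fun g hg hgs => ?_
  have hcs : HasCompactSupport fun x => (g x : ℂ) := hgs.comp_left Complex.ofReal_zero
  have hcd : ContDiff ℝ (⊤ : ℕ∞) fun x => (g x : ℂ) := Complex.ofRealCLM.contDiff.comp hg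
  set u : 𝓢(ℝ, ℂ) := hcs.toSchwartzMap hcd with hu
  have hux : ∀ x, u x = (g x : ℂ) := fun x => rfl
  have h1 : ∫ x, g x • Q x = ∫ x, u x • Q x := by simp [hux]
  have h2 : ∫ x, g x • f x = ∫ x, u x • f x := by simp [hux]
  rw [h1, h2, integral_mul_fourier_schwartz hf]
  have h3 := congrArg (fun T => T u) (Lp.fourierInv_toTemperedDistribution_eq (hF.toLp (𝓕 f)))
  simp only [TemperedDistribution.fourierInv_apply, Lp.toTemperedDistribution_apply] at h3
  rw [← hQ] at h3
  rw [← h3]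
  refine integral_congr_ae ?_
  filter_upwards [hF.coeFn_toLp] with w hw
  rw [hw]

theorem memLp_two_of_fourier {f : ℝ → ℂ} (hf : Integrable f) (hF : MemLp (𝓕 f) 2 volume) :
    MemLp f 2 volume :=
  (memLp_congr_ae (ae_eq_fourierInv_toLp hf hF)).mpr (Lp.memLp _)

theorem fourier_toLp_eq {f : ℝ → ℂ} (hf : Integrable f) (hF : MemLp (𝓕 f) 2 volume)
    (h2 : MemLp f 2 volume) : 𝓕 (h2.toLp f) = hF.toLp (𝓕 f) := by
  have h : h2.toLp f = 𝓕⁻ (hF.toLp (𝓕 f)) :=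
    Lp.ext (h2.coeFn_toLp.trans (ae_eq_fourierInv_toLp hf hF))
  rw [h, FourierTransform.fourier_fourierInv_eq]

/-- Plancherel's formula for the inner product with an integrable function whose Fourier
transform is square integrable. -/
theorem inner_toLp_eq_integral_fourier {f : ℝ → ℂ} (hf : Integrable f)
    (hF : MemLp (𝓕 f) 2 volume) (h2 : MemLp f 2 volume) (g : Lp ℂ 2 (volume : Measure ℝ)) :
    inner ℂ (h2.toLp f) g =
      ∫ w, (starRingEnd ℂ) (𝓕 f w) * (𝓕 g : Lp ℂ 2 (volume : Measure ℝ)) w := by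
  rw [← Lp.inner_fourier_eq, fourier_toLp_eq hf hF, L2.inner_def]
  refine integral_congr_ae ?_
  filter_upwards [hF.coeFn_toLp] with w hw
  rw [hw, RCLike.inner_apply']

/-! ### Fourier transforms of the Gabor atoms -/

theorem HasExpDecay.memLp_two {τ : ℝ} {G : ℝ → ℂ} (hτ : 0 < τ) (hG : HasExpDecay τ G) :
    MemLp G 2 volume := by
  rw [memLp_two_iff_integrable_sq_norm hG.continuous.aestronglyMeasurable]
  have h : Integrable fun x : ℝ => (1 + (τ⁻¹ * x) ^ 2)⁻¹ * ‖G 0‖ ^ 2 :=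
    (integrable_inv_one_add_sq.comp_mul_left' (inv_ne_zero hτ.ne')).mul_const _
  refine h.mono' (by have := hG.continuous; fun_prop) (Eventually.of_forall fun x => ?_)
  rw [Real.norm_of_nonneg (by positivity)]
  calc ‖G x‖ ^ 2 ≤ (Real.exp (-|x| / τ) * ‖G 0‖) ^ 2 := by
        gcongr; exact hG.norm_le_zero x
    _ ≤ (1 + (τ⁻¹ * x) ^ 2)⁻¹ * ‖G 0‖ ^ 2 := by
        rw [mul_pow]
        gcongr
        obtain ⟨t, ht⟩ : ∃ t, t = |x| / τ := ⟨_, rfl⟩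
        have ht0 : 0 ≤ t := ht ▸ by positivity
        have hx : (τ⁻¹ * x) ^ 2 = t ^ 2 := by
          rw [ht, div_pow, sq_abs]; field_simp
        rw [hx, neg_div, ← ht, Real.exp_neg, inv_pow]
        gcongr
        nlinarith [Real.add_one_le_exp t]

theorem fourier_gaborAtom (g : ℝ → ℂ) (α β : ℝ) (p : ℤ × ℤ) (w : ℝ) :
    𝓕 (gaborAtom g α β p) w =
      Complex.exp ((-2 * Real.pi * α * p.1 * (w - β * p.2) : ℝ) * Complex.I) *
        𝓕 g (w - β * p.2) := by
  rw [Real.fourier_real_eq_integral_exp_smul, Real.fourier_real_eq_integral_exp_smul,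
    ← integral_const_mul]
  conv_rhs => rw [← integral_sub_right_eq_self _ (α * (p.1 : ℝ))]
  congr 1
  ext x
  simp only [gaborAtom, smul_eq_mul]
  rw [← mul_assoc, ← mul_assoc, ← Complex.exp_add, ← Complex.exp_add]
  congr 2
  push_cast
  ring

theorem integrable_gaborAtom {g : ℝ → ℂ} (hg : Integrable g) (α β : ℝ) (p : ℤ × ℤ) :
    Integrable (gaborAtom g α β p) := by
  have h := hg.comp_sub_right (α * p.1)
  refine h.bdd_mul (c := 1) (by fun_prop) (Eventually.of_forall fun x => ?_)
  have : (2 * Real.pi * β * p.2 * x * Complex.I : ℂ) =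
    ((2 * Real.pi * β * p.2 * x : ℝ) : ℂ) * Complex.I := by push_cast; ring
  rw [this, Complex.norm_exp_ofReal_mul_I]

theorem memLp_fourier_gaborAtom {g : ℝ → ℂ} {τ : ℝ} (hτ : 0 < τ) (hg : HasExpDecay τ (𝓕 g))
    (α β : ℝ) (p : ℤ × ℤ) : MemLp (𝓕 (gaborAtom g α β p)) 2 volume := by
  have h := (hg.memLp_two hτ).comp_measurePreserving
    (measurePreserving_sub_right volume (β * p.2))
  have hc := hg.continuous
  refine h.of_le ?_ (Eventually.of_forall fun w => ?_)
  · have : 𝓕 (gaborAtom g α β p) = fun w => Complex.exp ((-2 * Real.pi * α * p.1 *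
      (w - β * p.2) : ℝ) * Complex.I) * 𝓕 g (w - β * p.2) :=
      funext (fourier_gaborAtom g α β p)
    rw [this]
    fun_prop
  · rw [fourier_gaborAtom, norm_mul, Complex.norm_exp_ofReal_mul_I, one_mul]
    rfl

/-! ### Matrix estimates on `ℓ²` -/

theorem ENNReal.two_mul_mul_le_sq_add_sq (x y : ℝ≥0∞) : 2 * (x * y) ≤ x ^ 2 + y ^ 2 := by
  wlog h : x ≤ y generalizing x y
  · rw [mul_comm x y, add_comm]
    exact this y x (le_of_not_ge h)
  obtain ⟨d, rfl⟩ := le_iff_exists_add.mp h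
  calc 2 * (x * (x + d)) ≤ 2 * (x * (x + d)) + d ^ 2 := le_self_add
    _ = x ^ 2 + (x + d) ^ 2 := by ring

theorem ENNReal.add_sq_le_two_mul (x y : ℝ≥0∞) : (x + y) ^ 2 ≤ 2 * x ^ 2 + 2 * y ^ 2 := by
  calc (x + y) ^ 2 = x ^ 2 + y ^ 2 + 2 * (x * y) := by ring
    _ ≤ x ^ 2 + y ^ 2 + (x ^ 2 + y ^ 2) := by gcongr; exact ENNReal.two_mul_mul_le_sq_add_sq x y
    _ = 2 * x ^ 2 + 2 * y ^ 2 := by ring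

/-- The Cauchy–Schwarz inequality for the weights `K`. -/
theorem ENNReal.sq_tsum_mul_le {κ : Type*} (K a : κ → ℝ≥0∞) :
    (∑' j, K j * a j) ^ 2 ≤ (∑' j, K j) * ∑' j, K j * a j ^ 2 := by
  have h : 2 * (∑' j, K j * a j) ^ 2 ≤ 2 * ((∑' j, K j) * ∑' j, K j * a j ^ 2) := by
    calc 2 * (∑' j, K j * a j) ^ 2
        = ∑' j, ∑' l, K j * K l * (2 * (a j * a l)) := by
          rw [sq, ← ENNReal.tsum_mul_right, ← ENNReal.tsum_mul_left]
          refine tsum_congr fun j => ?_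
          rw [← ENNReal.tsum_mul_left, ← ENNReal.tsum_mul_left]
          exact tsum_congr fun l => by ring
      _ ≤ ∑' j, ∑' l, (K j * a j ^ 2 * K l + K j * (K l * a l ^ 2)) := by
          refine ENNReal.tsum_le_tsum fun j => ENNReal.tsum_le_tsum fun l => ?_
          calc K j * K l * (2 * (a j * a l)) ≤ K j * K l * (a j ^ 2 + a l ^ 2) := by
                gcongr; exact ENNReal.two_mul_mul_le_sq_add_sq _ _
            _ = _ := by ring
      _ = 2 * ((∑' j, K j) * ∑' j, K j * a j ^ 2) := by
          simp_rw [ENNReal.tsum_add, ENNReal.tsum_mul_left, ENNReal.tsum_mul_right]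
          ring
  exact (ENNReal.mul_le_mul_iff_right two_ne_zero ENNReal.ofNat_ne_top).mp h

/-- Schur's test: a nonnegative matrix with row sums at most `R` and column sums at most `C` has
norm at most `√(R C)` on `ℓ²`. -/
theorem ENNReal.tsum_sq_tsum_mul_le {ι κ : Type*} (K : ι → κ → ℝ≥0∞) (a : κ → ℝ≥0∞)
    {R C : ℝ≥0∞} (hR : ∀ i, ∑' j, K i j ≤ R) (hC : ∀ j, ∑' i, K i j ≤ C) :
    ∑' i, (∑' j, K i j * a j) ^ 2 ≤ R * C * ∑' j, a j ^ 2 := by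
  calc ∑' i, (∑' j, K i j * a j) ^ 2 ≤ ∑' i, R * ∑' j, K i j * a j ^ 2 :=
        ENNReal.tsum_le_tsum fun i => (ENNReal.sq_tsum_mul_le _ _).trans
          (mul_le_mul_left (hR i) _)
    _ = R * ∑' j, (∑' i, K i j) * a j ^ 2 := by
        rw [ENNReal.tsum_mul_left, ENNReal.tsum_comm]
        simp_rw [ENNReal.tsum_mul_right]
    _ ≤ R * ∑' j, C * a j ^ 2 := by
        gcongr with j
        exact hC j
    _ = R * C * ∑' j, a j ^ 2 := by rw [ENNReal.tsum_mul_left, mul_assoc]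

/-- The two-sided geometric sequence `5^{-|j|}` with its central term removed. -/
def offDiagGeom (j : ℤ) : ℝ≥0∞ := if j = 0 then 0 else (5⁻¹) ^ j.natAbs

theorem tsum_offDiagGeom : ∑' j, offDiagGeom j = 2⁻¹ := by
  have h1 : ∑' n : ℕ, (5⁻¹ : ℝ≥0∞) ^ (n + 1) = 4⁻¹ := by
    simp_rw [pow_succ]
    rw [ENNReal.tsum_mul_right, ENNReal.tsum_geometric,
      ← ENNReal.toReal_eq_toReal_iff' (ENNReal.mul_ne_top (ENNReal.inv_ne_top.mpr
        (tsub_pos_of_lt (by norm_num)).ne') (by finiteness)) (by finiteness),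
      ENNReal.toReal_mul, ENNReal.toReal_inv, ENNReal.toReal_sub_of_le (by simp) (by simp)]
    norm_num
  have h2 : ∀ n : ℕ, offDiagGeom (-((n : ℤ) + 1)) = (5⁻¹ : ℝ≥0∞) ^ (n + 1) := by
    intro n
    rw [offDiagGeom, if_neg (by omega)]
    congr 1
  have h3 : ∀ n : ℕ, offDiagGeom ((n : ℤ) + 1) = (5⁻¹ : ℝ≥0∞) ^ (n + 1) := by
    intro n
    rw [offDiagGeom, if_neg (by omega)]
    congr 1
  rw [tsum_of_nat_of_neg_add_one ENNReal.summable ENNReal.summable,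
    tsum_eq_zero_add' ENNReal.summable]
  push_cast
  simp_rw [h2, h3, h1]
  rw [offDiagGeom, if_pos rfl, zero_add,
    ← ENNReal.toReal_eq_toReal_iff' (by finiteness) (by finiteness),
    ENNReal.toReal_add (by finiteness) (by finiteness)]
  norm_num

theorem offDiagGeom_neg (j : ℤ) : offDiagGeom (-j) = offDiagGeom j := by
  simp [offDiagGeom]

/-- The off-diagonal part contracts squared `ℓ²` norms by `1 / 4`, so that it can be absorbed by the
diagonal even after the loss of a factor `2` in `(x + y)² ≤ 2 x² + 2 y²`. -/
theorem tsum_sq_offDiagGeom_le (a : ℤ → ℝ≥0∞) :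
    ∑' n, (∑' n', offDiagGeom (n' - n) * a n') ^ 2 ≤ 2⁻¹ * 2⁻¹ * ∑' n, a n ^ 2 := by
  refine ENNReal.tsum_sq_tsum_mul_le (fun n n' => offDiagGeom (n' - n)) a (fun n => ?_)
    fun n' => ?_
  · rw [tsum_int_sub_right offDiagGeom n, tsum_offDiagGeom]
  · simp_rw [← neg_sub _ n', offDiagGeom_neg]
    rw [tsum_int_sub_right offDiagGeom n', tsum_offDiagGeom]

section Sampling

variable {τ T β : ℝ} {G : ℝ → ℂ}

theorem exists_schur_bounds (hτ : 0 < τ) (hG : HasExpDecay τ G) (hT : 0 < T) (hβ : 0 < β) :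
    ∃ R C : ℝ≥0∞, R ≠ ∞ ∧ C ≠ ∞ ∧ ∀ x : ℝ,
      (∀ m : ℤ, ∑' n : ℤ, ‖G (x + n * T - β * m)‖ₑ ≤ R) ∧
      (∀ n : ℤ, ∑' m : ℤ, ‖G (x + n * T - β * m)‖ₑ ≤ C) := by
  obtain ⟨R, hR, hR'⟩ := hG.exists_tsum_le hτ hT
  obtain ⟨C, hC, hC'⟩ := hG.exists_tsum_le hτ hβ
  refine ⟨R, C, hR, hC, fun x => ⟨fun m => ?_, fun n => ?_⟩⟩
  · simpa only [add_sub_right_comm] using hR' (x - β * m)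
  · rw [← (Equiv.neg ℤ).tsum_eq]
    convert! hC' (x + n * T) using 4 with m
    push_cast [Equiv.neg_apply]
    ring_nf

theorem summable_conj_mul (hτ : 0 < τ) (hG : HasExpDecay τ G) (hT : 0 < T) (hβ : 0 < β)
    {a : ℤ → ℂ} (ha : ∑' n, ‖a n‖ₑ ^ 2 ≠ ∞) (x : ℝ) (m : ℤ) :
    Summable fun n : ℤ => (starRingEnd ℂ) (G (x + n * T - β * m)) * a n := by
  obtain ⟨R, C, hR, hC, h⟩ := exists_schur_bounds hτ hG hT hβ
  have h1 := ENNReal.tsum_sq_tsum_mul_le (fun m n : ℤ => ‖G (x + n * T - β * m)‖ₑ)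
    (fun n => ‖a n‖ₑ) (h x).1 (h x).2
  have h2 := ne_top_of_le_ne_top (ENNReal.mul_ne_top (ENNReal.mul_ne_top hR hC) ha)
    ((ENNReal.le_tsum m).trans h1)
  have h3 := (ENNReal.pow_ne_top_iff.mp h2).resolve_right two_ne_zero
  refine Summable.of_enorm (ne_top_of_le_ne_top h3 (le_of_eq (tsum_congr fun n => ?_)))
  rw [enorm_mul, RCLike.enorm_conj]

theorem exists_tsum_sq_tsum_le (hτ : 0 < τ) (hG : HasExpDecay τ G) (hT : 0 < T) (hβ : 0 < β) :
    ∃ B : ℝ≥0∞, B ≠ ∞ ∧ ∀ (x : ℝ) (a : ℤ → ℂ),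
      ∑' m : ℤ, ‖∑' n : ℤ, (starRingEnd ℂ) (G (x + n * T - β * m)) * a n‖ₑ ^ 2 ≤
        B * ∑' n, ‖a n‖ₑ ^ 2 := by
  obtain ⟨R, C, hR, hC, h⟩ := exists_schur_bounds hτ hG hT hβ
  refine ⟨R * C, ENNReal.mul_ne_top hR hC, fun x a => le_trans ?_
    (ENNReal.tsum_sq_tsum_mul_le (fun m n : ℤ => ‖G (x + n * T - β * m)‖ₑ)
      (fun n => ‖a n‖ₑ) (h x).1 (h x).2)⟩
  gcongr with m
  refine enorm_tsum_le_tsum_enorm.trans (le_of_eq (tsum_congr fun n => ?_))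
  rw [enorm_mul, RCLike.enorm_conj]

/-- In the row `m` of an integer with `|x + n T - β m| ≤ β / 2`, the entry in column `n` dominates:
every other `x + n' T` is farther from `β m` by at least `|n' - n| (T - β)`. -/
theorem HasExpDecay.enorm_le_offDiagGeom (hτ : 0 < τ) (hG : HasExpDecay τ G) (hβT : β < T)
    (hdec : Real.exp (-(T - β) / τ) ≤ 5⁻¹) (hβ : 0 < β) {x : ℝ} {m n : ℤ}
    (hm : |x + n * T - β * m| ≤ β / 2) {n' : ℤ} (hn : n' ≠ n) :
    ‖G (x + n' * T - β * m)‖ₑ ≤ offDiagGeom (n' - n) * ‖G (x + n * T - β * m)‖ₑ := by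
  have hT : 0 < T := hβ.trans hβT
  have hj : (1 : ℝ) ≤ |((n' - n : ℤ) : ℝ)| := by
    exact_mod_cast Int.one_le_abs (sub_ne_zero.mpr hn)
  have hd := abs_sub_mul_sub_abs_le_abs (x := x - β * m) hT n n'
  rw [← add_sub_right_comm, ← add_sub_right_comm] at hd
  have hd2 : |((n' - n : ℤ) : ℝ)| * (T - β) ≤
      |x + n' * T - β * m| - |x + n * T - β * m| := by nlinarith
  have hle : |x + n * T - β * m| ≤ |x + n' * T - β * m| := by nlinarith
  have key : ‖G (x + n' * T - β * m)‖ ≤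
      (5⁻¹ : ℝ) ^ (n' - n).natAbs * ‖G (x + n * T - β * m)‖ := by
    refine (hG.norm_le _ _ hle).trans ?_
    gcongr
    calc Real.exp ((|x + n * T - β * m| - |x + n' * T - β * m|) / τ)
        ≤ Real.exp (((n' - n).natAbs : ℕ) * (-(T - β) / τ)) := by
          rw [Nat.cast_natAbs, Int.cast_abs, ← mul_div_assoc]
          gcongr
          linarith
      _ = Real.exp (-(T - β) / τ) ^ (n' - n).natAbs := Real.exp_nat_mul _ _
      _ ≤ _ := by gcongr
  rw [offDiagGeom, if_neg (sub_ne_zero.mpr hn), ← ofReal_norm, ← ofReal_norm]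
  refine (ENNReal.ofReal_le_ofReal key).trans (le_of_eq ?_)
  rw [ENNReal.ofReal_mul (by positivity), ENNReal.ofReal_pow (by positivity),
    ENNReal.ofReal_inv_of_pos (by norm_num), ENNReal.ofReal_ofNat]

/-- Choose for each `n` the integer `m` for which `β m` is nearest to `x + n T`. Since `β < T`, this
choice is injective, and the rows so chosen form a diagonally dominant matrix, which is
therefore bounded below. -/
theorem tsum_sq_le_tsum_sq_tsum (hτ : 0 < τ) (hG : HasExpDecay τ G) (hβ : 0 < β) (hβT : β < T)
    (hdec : Real.exp (-(T - β) / τ) ≤ 5⁻¹) {a : ℤ → ℂ} (ha : ∑' n, ‖a n‖ₑ ^ 2 ≠ ∞) (x : ℝ) :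
    ∑' n, ‖a n‖ₑ ^ 2 ≤ 4 * (‖G (β / 2)‖ₑ⁻¹) ^ 2 *
      ∑' m : ℤ, ‖∑' n : ℤ, (starRingEnd ℂ) (G (x + n * T - β * m)) * a n‖ₑ ^ 2 := by
  have hT : 0 < T := hβ.trans hβT
  set b : ℤ → ℂ := fun m => ∑' n : ℤ, (starRingEnd ℂ) (G (x + n * T - β * m)) * a n with hb
  set s : ℤ → ℝ≥0∞ := fun n => ∑' n', offDiagGeom (n' - n) * ‖a n'‖ₑ with hs
  have hr : ∀ n : ℤ, ∃ m : ℤ, |x + n * T - β * m| ≤ β / 2 := by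
    intro n
    obtain ⟨k, hk⟩ := exists_abs_add_mul_le hβ (x + n * T)
    refine ⟨-k, ?_⟩
    convert! hk using 2
    push_cast
    ring
  choose r hr using hr
  have hinj : Function.Injective r := by
    intro n n' h
    by_contra hne
    have h1 := hr n
    have h2 := hr n'
    rw [← h] at h2
    have hd := abs_sub_mul_sub_abs_le_abs (x := x - β * r n) hT n n'
    rw [← add_sub_right_comm, ← add_sub_right_comm] at hd
    have hj : (1 : ℝ) ≤ |((n' - n : ℤ) : ℝ)| := by
      exact_mod_cast Int.one_le_abs (sub_ne_zero.mpr (Ne.symm hne))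
    nlinarith
  have hrow : ∀ n, ‖a n‖ₑ ≤ ‖G (β / 2)‖ₑ⁻¹ * ‖b (r n)‖ₑ + s n := by
    intro n
    set D := ‖G (x + n * T - β * r n)‖ₑ with hD
    have hD0 : D ≠ 0 := by rw [hD, enorm_ne_zero]; exact hG.ne_zero _
    have hDle : ‖G (β / 2)‖ₑ ≤ D := by
      rw [hD, ← ofReal_norm, ← ofReal_norm]
      apply ENNReal.ofReal_le_ofReal
      have hle : |x + n * T - β * r n| ≤ |β / 2| := (hr n).trans (le_abs_self _)
      refine (hG.norm_le _ _ hle).trans (mul_le_of_le_one_left (norm_nonneg _) ?_)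
      exact Real.exp_le_one_iff.mpr
        (div_nonpos_of_nonpos_of_nonneg (sub_nonpos.mpr hle) hτ.le)
    have hsum := summable_conj_mul hτ hG hT hβ ha x (r n)
    have hsplit := hsum.tsum_eq_add_tsum_ite n
    have hbn : (starRingEnd ℂ) (G (x + n * T - β * r n)) * a n =
        b (r n) - ∑' n', if n' = n then 0 else
          (starRingEnd ℂ) (G (x + n' * T - β * r n)) * a n' := by
      rw [hb]
      exact eq_sub_of_add_eq hsplit.symm
    have h1 : D * ‖a n‖ₑ ≤ ‖b (r n)‖ₑ + D * s n := by
      calc D * ‖a n‖ₑ = ‖(starRingEnd ℂ) (G (x + n * T - β * r n)) * a n‖ₑ := by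
            rw [enorm_mul, RCLike.enorm_conj]
        _ ≤ ‖b (r n)‖ₑ + ‖∑' n', if n' = n then 0 else
              (starRingEnd ℂ) (G (x + n' * T - β * r n)) * a n'‖ₑ := by
            rw [hbn]; exact enorm_sub_le
        _ ≤ ‖b (r n)‖ₑ + D * s n := by
            gcongr
            refine enorm_tsum_le_tsum_enorm.trans ?_
            rw [hs, ← ENNReal.tsum_mul_left]
            refine ENNReal.tsum_le_tsum fun n' => ?_
            split_ifs with h
            · simp
            · rw [enorm_mul, RCLike.enorm_conj, ← mul_assoc, mul_comm D]
              gcongr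
              exact hG.enorm_le_offDiagGeom hτ hβT hdec hβ (hr n) h
    have hDt : D ≠ ∞ := enorm_ne_top
    calc ‖a n‖ₑ = D⁻¹ * (D * ‖a n‖ₑ) := by
          rw [← mul_assoc, ENNReal.inv_mul_cancel hD0 hDt, one_mul]
      _ ≤ D⁻¹ * (‖b (r n)‖ₑ + D * s n) := by gcongr
      _ = D⁻¹ * ‖b (r n)‖ₑ + s n := by
          rw [mul_add, ← mul_assoc D⁻¹ D, ENNReal.inv_mul_cancel hD0 hDt, one_mul]
      _ ≤ _ := by gcongr
  have hX : ∑' n, ‖a n‖ₑ ^ 2 ≤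
      2 * (‖G (β / 2)‖ₑ⁻¹) ^ 2 * (∑' m, ‖b m‖ₑ ^ 2) + (∑' n, ‖a n‖ₑ ^ 2) / 2 := by
    calc ∑' n, ‖a n‖ₑ ^ 2
        ≤ ∑' n, (2 * (‖G (β / 2)‖ₑ⁻¹) ^ 2 * ‖b (r n)‖ₑ ^ 2 + 2 * s n ^ 2) := by
          refine ENNReal.tsum_le_tsum fun n => ?_
          refine (pow_le_pow_left' (hrow n) 2).trans
            ((ENNReal.add_sq_le_two_mul _ _).trans (le_of_eq ?_))
          rw [mul_pow, mul_assoc]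
      _ = 2 * (‖G (β / 2)‖ₑ⁻¹) ^ 2 * (∑' n, ‖b (r n)‖ₑ ^ 2) + 2 * ∑' n, s n ^ 2 := by
          rw [ENNReal.tsum_add, ENNReal.tsum_mul_left, ENNReal.tsum_mul_left]
      _ ≤ 2 * (‖G (β / 2)‖ₑ⁻¹) ^ 2 * (∑' m, ‖b m‖ₑ ^ 2) +
            2 * (2⁻¹ * 2⁻¹ * ∑' n, ‖a n‖ₑ ^ 2) := by
          refine add_le_add (mul_le_mul_right ?_ _) (mul_le_mul_right ?_ _)
          · exact ENNReal.tsum_comp_le_tsum_of_injective hinj fun m => ‖b m‖ₑ ^ 2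
          · exact tsum_sq_offDiagGeom_le fun n => ‖a n‖ₑ
      _ = _ := by
          rw [← mul_assoc 2, ← mul_assoc 2, ENNReal.mul_inv_cancel two_ne_zero ENNReal.ofNat_ne_top,
            one_mul, ENNReal.div_eq_inv_mul]
  have hhalf : (∑' n, ‖a n‖ₑ ^ 2) / 2 ≤ 2 * (‖G (β / 2)‖ₑ⁻¹) ^ 2 * ∑' m, ‖b m‖ₑ ^ 2 := by
    -- finiteness of the sum is what allows the cancellation
    have hfin : (∑' n, ‖a n‖ₑ ^ 2) / 2 ≠ ∞ := ENNReal.div_ne_top ha two_ne_zero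
    refine (ENNReal.add_le_add_iff_right hfin).mp ?_
    rwa [ENNReal.add_halves]
  calc ∑' n, ‖a n‖ₑ ^ 2 = 2 * ((∑' n, ‖a n‖ₑ ^ 2) / 2) :=
        (ENNReal.mul_div_cancel two_ne_zero ENNReal.ofNat_ne_top).symm
    _ ≤ 2 * (2 * (‖G (β / 2)‖ₑ⁻¹) ^ 2 * ∑' m, ‖b m‖ₑ ^ 2) := by gcongr
    _ = _ := by ring

end Sampling

/-! ### Periodization and Parseval's identity -/

/-- Lebesgue measure is the sum of the translates of its restriction to a fundamental domain. -/
theorem volume_eq_sum_map_add_mul {T : ℝ} (hT : 0 < T) :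
    (volume : Measure ℝ) = Measure.sum fun n : ℤ =>
      (volume.restrict (Set.Ioc 0 T)).map (fun w => w + n * T) := by
  have h1 : (volume : Measure ℝ) = Measure.sum fun n : ℤ =>
      volume.restrict (Set.Ioc (n • T) ((n + 1) • T)) := by
    rw [← Measure.restrict_iUnion (Set.pairwise_disjoint_Ioc_zsmul T) fun n => measurableSet_Ioc,
      iUnion_Ioc_zsmul hT, Measure.restrict_univ]
  rw [h1]
  congr 1
  ext1 n
  have h2 := ((measurePreserving_add_right volume ((n : ℝ) * T)).restrict_preimage_emb
    (measurableEmbedding_addRight _) (Set.Ioc (n • T) ((n + 1) • T))).map_eq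
  rw [← h2, ← h1]
  congr 2
  ext w
  simp only [Set.mem_preimage, Set.mem_Ioc, zsmul_eq_mul]
  push_cast
  constructor <;> rintro ⟨h3, h4⟩ <;> constructor <;> linarith

theorem lintegral_eq_lintegral_tsum_add {T : ℝ} (hT : 0 < T) {f : ℝ → ℝ≥0∞} (hf : Measurable f) :
    ∫⁻ w, f w = ∫⁻ w in Set.Ioc 0 T, ∑' n : ℤ, f (w + n * T) := by
  conv_lhs => rw [volume_eq_sum_map_add_mul hT]
  rw [lintegral_sum_measure, lintegral_tsum fun n => by fun_prop]
  exact tsum_congr fun n => lintegral_map hf (by fun_prop)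

theorem integral_eq_integral_tsum_add {T : ℝ} (hT : 0 < T) {f : ℝ → ℂ} (hf : Measurable f)
    (hi : Integrable f) :
    ∫ w, f w = ∫ w in Set.Ioc 0 T, ∑' n : ℤ, f (w + n * T) := by
  have hm : ∀ n : ℤ, Measurable fun w : ℝ => f (w + n * T) := fun n => hf.comp (by fun_prop)
  rw [integral_tsum fun n => (hm n).aestronglyMeasurable]
  · have hi' := hi
    rw [volume_eq_sum_map_add_mul hT] at hi'
    conv_lhs => rw [volume_eq_sum_map_add_mul hT]
    rw [← (hasSum_integral_measure hi').tsum_eq]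
    exact tsum_congr fun n => integral_map (by fun_prop) hf.aestronglyMeasurable
  · rw [← lintegral_tsum fun n => by fun_prop, ← lintegral_eq_lintegral_tsum_add hT hf.enorm]
    exact hi.2.ne

theorem enorm_sq_eq_ofReal (z : ℂ) : ‖z‖ₑ ^ 2 = ENNReal.ofReal (‖z‖ ^ 2) := by
  rw [← ofReal_norm, ENNReal.ofReal_pow (norm_nonneg _)]

/-- The numbers `∫ e^{2πikw/T} H(w) dw` are, up to the factor `T`, the Fourier coefficients of the
`T`-periodization of `H`. -/
theorem tsum_sq_integral_eq_lintegral_periodization {T : ℝ} (hT : 0 < T) {H : ℝ → ℂ}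
    (hH : Measurable H) (hi : Integrable H)
    (h2 : ∫⁻ w in Set.Ioc 0 T, ‖∑' n : ℤ, H (w + n * T)‖ₑ ^ 2 ≠ ∞) :
    ∑' k : ℤ, ‖∫ w : ℝ, Complex.exp (2 * Real.pi * Complex.I * k * w / T) * H w‖ₑ ^ 2 =
      ENNReal.ofReal T * ∫⁻ w in Set.Ioc 0 T, ‖∑' n : ℤ, H (w + n * T)‖ₑ ^ 2 := by
  set P : ℝ → ℂ := fun w => ∑' n : ℤ, H (w + n * T) with hP
  have hPm : Measurable P := Measurable.tsum fun n => by fun_prop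
  have hL2 : MemLp P 2 (volume.restrict (Set.Ioc 0 T)) := by
    refine ⟨hPm.aestronglyMeasurable, ?_⟩
    rw [eLpNorm_lt_top_iff_lintegral_rpow_enorm_lt_top two_ne_zero ENNReal.ofNat_ne_top]
    simpa using h2.lt_top
  have hcoeff : ∀ k : ℤ, ∫ w : ℝ, Complex.exp (2 * Real.pi * Complex.I * k * w / T) * H w =
      T * fourierCoeffOn hT P (-k) := by
    intro k
    have hT' : (T : ℂ) ≠ 0 := Complex.ofReal_ne_zero.mpr hT.ne'
    have hint : Integrable fun w : ℝ =>
        Complex.exp (2 * Real.pi * Complex.I * k * w / T) * H w := by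
      refine hi.bdd_mul (c := 1) (by fun_prop) (Eventually.of_forall fun w => ?_)
      have : (2 * Real.pi * Complex.I * k * w / T : ℂ) =
        ((2 * Real.pi * k * w / T : ℝ) : ℂ) * Complex.I := by push_cast; ring
      rw [this, Complex.norm_exp_ofReal_mul_I]
    rw [integral_eq_integral_tsum_add hT (by fun_prop) hint, fourierCoeffOn_eq_integral,
      intervalIntegral.integral_of_le hT.le, sub_zero, Complex.real_smul, ← mul_assoc]
    have hTT : (T : ℂ) * ((1 / T : ℝ) : ℂ) = 1 := by
      push_cast; field_simp
    rw [hTT, one_mul]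
    refine integral_congr_ae (Eventually.of_forall fun w => ?_)
    simp only [neg_neg, fourier_coe_apply, smul_eq_mul, hP]
    rw [← tsum_mul_left]
    refine tsum_congr fun n => ?_
    congr 1
    rw [Complex.exp_eq_exp_iff_exists_int]
    refine ⟨k * n, ?_⟩
    push_cast
    field_simp
  have hsum := hasSum_sq_fourierCoeffOn hT hL2
  have hlint : ∫⁻ w in Set.Ioc 0 T, ‖P w‖ₑ ^ 2 =
      ENNReal.ofReal (∫ w in (0 : ℝ)..T, ‖P w‖ ^ 2) := by
    rw [intervalIntegral.integral_of_le hT.le, ofReal_integral_eq_lintegral_ofReal]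
    · simp_rw [enorm_sq_eq_ofReal]
    · exact (memLp_two_iff_integrable_sq_norm hL2.1).mp hL2
    · exact Eventually.of_forall fun w => sq_nonneg _
  calc ∑' k : ℤ, ‖∫ w : ℝ, Complex.exp (2 * Real.pi * Complex.I * k * w / T) * H w‖ₑ ^ 2
      = ∑' k : ℤ, ENNReal.ofReal (T ^ 2) * ENNReal.ofReal (‖fourierCoeffOn hT P (-k)‖ ^ 2) := by
        refine tsum_congr fun k => ?_
        rw [hcoeff, enorm_sq_eq_ofReal, norm_mul, mul_pow, ENNReal.ofReal_mul (by positivity),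
          Complex.norm_real, Real.norm_eq_abs, sq_abs]
    _ = ENNReal.ofReal (T ^ 2) * ∑' k : ℤ, ENNReal.ofReal (‖fourierCoeffOn hT P k‖ ^ 2) := by
        rw [ENNReal.tsum_mul_left]
        congr 1
        exact (Equiv.neg ℤ).tsum_eq fun k => ENNReal.ofReal (‖fourierCoeffOn hT P k‖ ^ 2)
    _ = ENNReal.ofReal (T ^ 2) * ENNReal.ofReal ((T - 0)⁻¹ • ∫ w in (0 : ℝ)..T, ‖P w‖ ^ 2) := by
        rw [← ENNReal.ofReal_tsum_of_nonneg (fun k => sq_nonneg _) hsum.summable, hsum.tsum_eq]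
    _ = _ := by
        rw [hlint, ← ENNReal.ofReal_mul (by positivity), ← ENNReal.ofReal_mul hT.le, sub_zero,
          smul_eq_mul]
        congr 1
        field_simp

/-! ### Gabor frames with exponentially decaying window on the Fourier side -/

theorem isHilbertFrame_of_enorm_bounds {ι H : Type*} [NormedAddCommGroup H]
    [InnerProductSpace ℂ H] {e : ι → H} {c₁ c₂ : ℝ≥0∞} (h₁ : c₁ ≠ ∞) (h₂ : c₂ ≠ ∞)
    (hlow : ∀ f : H, ‖f‖ₑ ^ 2 ≤ c₁ * ∑' i, ‖inner ℂ (e i) f‖ₑ ^ 2)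
    (hup : ∀ f : H, ∑' i, ‖inner ℂ (e i) f‖ₑ ^ 2 ≤ c₂ * ‖f‖ₑ ^ 2) : IsHilbertFrame e := by
  refine ⟨(c₁.toReal + 1)⁻¹, c₂.toReal + 1, by positivity, by positivity, fun f => ?_⟩
  have htop : ∑' i, ‖inner ℂ (e i) f‖ₑ ^ 2 ≠ ∞ :=
    ne_top_of_le_ne_top (ENNReal.mul_ne_top h₂ (by finiteness)) (hup f)
  have htr : ∀ i, (‖inner ℂ (e i) f‖ₑ ^ 2).toReal = ‖inner ℂ (e i) f‖ ^ 2 := fun i => by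
    rw [ENNReal.toReal_pow, toReal_enorm]
  have hsum : Summable fun i => ‖inner ℂ (e i) f‖ ^ 2 := by
    simpa only [htr] using ENNReal.summable_toReal htop
  have hS : (∑' i, ‖inner ℂ (e i) f‖ₑ ^ 2).toReal = ∑' i, ‖inner ℂ (e i) f‖ ^ 2 := by
    rw [ENNReal.tsum_toReal_eq fun i => by finiteness]
    exact tsum_congr htr
  have hS0 : 0 ≤ ∑' i, ‖inner ℂ (e i) f‖ ^ 2 := tsum_nonneg fun i => sq_nonneg _
  have hl := ENNReal.toReal_mono (ENNReal.mul_ne_top h₁ htop) (hlow f)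
  have hu := ENNReal.toReal_mono (ENNReal.mul_ne_top h₂ (by finiteness)) (hup f)
  rw [ENNReal.toReal_mul, ENNReal.toReal_pow, toReal_enorm, hS] at hl hu
  refine ⟨hsum, ?_, ?_⟩
  · rw [inv_mul_le_iff₀ (by positivity)]
    linarith
  · nlinarith [sq_nonneg ‖f‖]

theorem enorm_sq_eq_lintegral (F : Lp ℂ 2 (volume : Measure ℝ)) :
    ‖F‖ₑ ^ 2 = ∫⁻ w, ‖F w‖ₑ ^ 2 := by
  have h := eLpNorm_nnreal_pow_eq_lintegral (μ := volume) (f := F) (p := 2) two_ne_zero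
  rw [Lp.enorm_def]
  simpa using h

/-- The analysis coefficients of `f` with respect to a Gabor system, summed over all time shifts
and modulations, in terms of the fibres `(f̂(w + n T))_n`, `T = 1 / α`. -/
theorem tsum_sq_inner_gaborAtom {g : ℝ → ℂ} (hg : Integrable g) {τ : ℝ} (hτ : 0 < τ)
    (hG : HasExpDecay τ (𝓕 g)) {α β : ℝ} (hα : 0 < α)
    (hL : ∀ p, MemLp (gaborAtom g α β p) 2 volume) (f : Lp ℂ 2 (volume : Measure ℝ))
    {F : Lp ℂ 2 (volume : Measure ℝ)} (hF : F = 𝓕 f)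
    (hfin : ∫⁻ w in Set.Ioc 0 (1 / α), ∑' m : ℤ, ‖∑' n : ℤ,
      (starRingEnd ℂ) (𝓕 g (w + n * (1 / α) - β * m)) * F (w + n * (1 / α))‖ₑ ^ 2 ≠ ∞) :
    ∑' p, ‖inner ℂ ((hL p).toLp (gaborAtom g α β p)) f‖ₑ ^ 2 =
      ENNReal.ofReal (1 / α) * ∫⁻ w in Set.Ioc 0 (1 / α), ∑' m : ℤ, ‖∑' n : ℤ,
        (starRingEnd ℂ) (𝓕 g (w + n * (1 / α) - β * m)) * F (w + n * (1 / α))‖ₑ ^ 2 := by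
  have hT : 0 < 1 / α := by positivity
  have hFm : Measurable F := (Lp.stronglyMeasurable F).measurable
  have hGm : Measurable (𝓕 g) := hG.continuous.measurable
  have hconj : Measurable (starRingEnd ℂ) := Complex.continuous_conj.measurable
  set H : ℤ → ℝ → ℂ := fun m w => (starRingEnd ℂ) (𝓕 g (w - β * m)) * F w with hH
  have hHm : ∀ m, Measurable (H m) := fun m => by
    refine (hconj.comp (hGm.comp (by fun_prop))).mul hFm
  have hHi : ∀ m, Integrable (H m) := fun m =>
    MemLp.integrable_mul (((hG.memLp_two hτ).comp_measurePreserving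
      (measurePreserving_sub_right volume (β * m))).star) (Lp.memLp F)
  have hPm : ∀ m : ℤ, Measurable fun w => ‖∑' n : ℤ, H m (w + n * (1 / α))‖ₑ ^ 2 := fun m => by
    have : Measurable fun w => ∑' n : ℤ, H m (w + n * (1 / α)) :=
      Measurable.tsum fun n => (hHm m).comp (by fun_prop)
    exact this.enorm.pow_const 2
  have hswap := lintegral_tsum (μ := volume.restrict (Set.Ioc 0 (1 / α)))
    fun m => (hPm m).aemeasurable
  have hinner : ∀ k m : ℤ, ‖inner ℂ ((hL (k, m)).toLp (gaborAtom g α β (k, m))) f‖ₑ =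
      ‖∫ w : ℝ, Complex.exp (2 * Real.pi * Complex.I * k * w / (1 / α : ℝ)) * H m w‖ₑ := by
    intro k m
    rw [inner_toLp_eq_integral_fourier (integrable_gaborAtom hg α β _)
      (memLp_fourier_gaborAtom hτ hG α β _), ← hF]
    have hpt : ∀ w : ℝ, (starRingEnd ℂ) (𝓕 (gaborAtom g α β (k, m)) w) * F w =
        Complex.exp ((-(2 * Real.pi * α * k * β * m) : ℝ) * Complex.I) *
          (Complex.exp (2 * Real.pi * Complex.I * k * w / (1 / α : ℝ)) * H m w) := by
      intro w
      rw [fourier_gaborAtom, map_mul, ← Complex.exp_conj, map_mul, Complex.conj_I,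
        Complex.conj_ofReal, ← mul_assoc, ← Complex.exp_add, hH, ← mul_assoc]
      congr 3
      have : (α : ℂ) ≠ 0 := Complex.ofReal_ne_zero.mpr hα.ne'
      push_cast
      field_simp
      ring
    simp_rw [hpt]
    rw [integral_const_mul, enorm_mul, ← ofReal_norm (Complex.exp _),
      Complex.norm_exp_ofReal_mul_I, ENNReal.ofReal_one, one_mul]
  calc ∑' p, ‖inner ℂ ((hL p).toLp (gaborAtom g α β p)) f‖ₑ ^ 2
      = ∑' m : ℤ, ∑' k : ℤ,
          ‖∫ w : ℝ, Complex.exp (2 * Real.pi * Complex.I * k * w / (1 / α : ℝ)) * H m w‖ₑ ^ 2 := by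
        rw [ENNReal.tsum_prod', ENNReal.tsum_comm]
        simp_rw [hinner]
    _ = ∑' m : ℤ, ENNReal.ofReal (1 / α) *
          ∫⁻ w in Set.Ioc 0 (1 / α), ‖∑' n : ℤ, H m (w + n * (1 / α))‖ₑ ^ 2 := by
        refine tsum_congr fun m =>
          tsum_sq_integral_eq_lintegral_periodization hT (hHm m) (hHi m) ?_
        refine ne_top_of_le_ne_top hfin (lintegral_mono fun w => ?_)
        exact ENNReal.le_tsum (f := fun m : ℤ => ‖∑' n : ℤ, H m (w + n * (1 / α))‖ₑ ^ 2) m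
    _ = _ := by rw [ENNReal.tsum_mul_left, ← hswap]

theorem isGaborFrame_of_hasExpDecay {g : ℝ → ℂ} (hg : Integrable g) {τ : ℝ} (hτ : 0 < τ)
    (hG : HasExpDecay τ (𝓕 g)) {α β : ℝ} (hα : 0 < α) (hβ : 0 < β) (hβα : β < 1 / α)
    (hdec : Real.exp (-(1 / α - β) / τ) ≤ 5⁻¹) : IsGaborFrame g α β := by
  have hT : 0 < 1 / α := by positivity
  have hL : ∀ p, MemLp (gaborAtom g α β p) 2 volume := fun p =>
    memLp_two_of_fourier (integrable_gaborAtom hg α β p) (memLp_fourier_gaborAtom hτ hG α β p)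
  obtain ⟨B, hB, hBle⟩ := exists_tsum_sq_tsum_le hτ hG hT hβ
  have hD0 : ‖𝓕 g (β / 2)‖ₑ ≠ 0 := by
    rw [enorm_ne_zero]; exact hG.ne_zero _
  have hA : 4 * (‖𝓕 g (β / 2)‖ₑ⁻¹) ^ 2 ≠ ∞ :=
    ENNReal.mul_ne_top ENNReal.ofNat_ne_top (ENNReal.pow_ne_top (ENNReal.inv_ne_top.mpr hD0))
  have hnorm : ∀ f : Lp ℂ 2 (volume : Measure ℝ), ‖f‖ₑ ^ 2 = ∫⁻ w in Set.Ioc 0 (1 / α),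
      ∑' n : ℤ, ‖(𝓕 f : Lp ℂ 2 (volume : Measure ℝ)) (w + n * (1 / α))‖ₑ ^ 2 := by
    intro f
    have hm : Measurable (𝓕 f : Lp ℂ 2 (volume : Measure ℝ)) :=
      (Lp.stronglyMeasurable _).measurable
    have h1 : ‖(𝓕 f : Lp ℂ 2 (volume : Measure ℝ))‖ₑ = ‖f‖ₑ := by
      rw [← ofReal_norm, ← ofReal_norm, Lp.norm_fourier_eq]
    rw [← h1, enorm_sq_eq_lintegral]
    exact lintegral_eq_lintegral_tsum_add hT (hm.enorm.pow_const 2)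
  have hup : ∀ f : Lp ℂ 2 (volume : Measure ℝ), ∫⁻ w in Set.Ioc 0 (1 / α), ∑' m : ℤ, ‖∑' n : ℤ,
      (starRingEnd ℂ) (𝓕 g (w + n * (1 / α) - β * m)) *
        (𝓕 f : Lp ℂ 2 (volume : Measure ℝ)) (w + n * (1 / α))‖ₑ ^ 2 ≤ B * ‖f‖ₑ ^ 2 := by
    intro f
    rw [hnorm f, ← lintegral_const_mul' _ _ hB]
    exact lintegral_mono fun w => hBle w _
  have hfin := fun f => ne_top_of_le_ne_top
    (ENNReal.mul_ne_top hB (ENNReal.pow_ne_top enorm_ne_top)) (hup f)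
  refine ⟨hL, isHilbertFrame_of_enorm_bounds
    (c₁ := 4 * (‖𝓕 g (β / 2)‖ₑ⁻¹) ^ 2 * (ENNReal.ofReal (1 / α))⁻¹)
    (c₂ := ENNReal.ofReal (1 / α) * B) ?_ (ENNReal.mul_ne_top ENNReal.ofReal_ne_top hB)
    (fun f => ?_) fun f => ?_⟩
  · exact ENNReal.mul_ne_top hA (ENNReal.inv_ne_top.mpr (ENNReal.ofReal_pos.mpr hT).ne')
  · rw [tsum_sq_inner_gaborAtom hg hτ hG hα hL f rfl (hfin f), mul_assoc, ← mul_assoc _⁻¹,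
      ENNReal.inv_mul_cancel (ENNReal.ofReal_pos.mpr hT).ne' ENNReal.ofReal_ne_top, one_mul,
      ← lintegral_const_mul' _ _ hA]
    have hm : Measurable (𝓕 f : Lp ℂ 2 (volume : Measure ℝ)) :=
      (Lp.stronglyMeasurable _).measurable
    have hae : ∀ᵐ w ∂volume.restrict (Set.Ioc 0 (1 / α)),
        ∑' n : ℤ, ‖(𝓕 f : Lp ℂ 2 (volume : Measure ℝ)) (w + n * (1 / α))‖ₑ ^ 2 < ∞ := by
      refine ae_lt_top (Measurable.tsum fun n => ?_) ?_
      · exact (hm.comp (by fun_prop)).enorm.pow_const 2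
      · rw [← hnorm f]; finiteness
    rw [hnorm f]
    refine lintegral_mono_ae ?_
    filter_upwards [hae] with w hw
    exact tsum_sq_le_tsum_sq_tsum hτ hG hβ hβα hdec hw.ne w
  · rw [tsum_sq_inner_gaborAtom hg hτ hG hα hL f rfl (hfin f), mul_assoc]
    gcongr
    exact hup f

theorem exists_isGaborFrame_dilate {φ : ℝ → ℂ} (hφ : IsTypeII φ) {p : ℝ} (hp : 0 < p)
    (hp1 : p < 1) : ∃ c : ℝ, 0 < c ∧ ∀ α β : ℝ, 0 < α → 0 < β → α * β = p →
      IsGaborFrame (dilate φ (c * β)) α β := by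
  have hc : 0 < (p⁻¹ - 1) / 2 := by
    have := (one_lt_inv₀ hp).mpr hp1
    linarith
  refine ⟨(p⁻¹ - 1) / 2, hc, fun α β hα hβ h => ?_⟩
  have hγ : 0 < (p⁻¹ - 1) / 2 * β := by positivity
  have hgap : 1 / α - β = 2 * ((p⁻¹ - 1) / 2 * β) := by
    rw [← h]; field_simp
  refine isGaborFrame_of_hasExpDecay (integrable_dilate hφ.1 hγ) hγ
    (hφ.hasExpDecay_fourier_dilate hγ) hα hβ (by linarith) ?_
  -- the rows decay by the factor `e^{-2} < 1 / 5` at each step away from the diagonal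
  have h2 : -(1 / α - β) / ((p⁻¹ - 1) / 2 * β) = -2 := by
    rw [hgap, ← neg_mul, mul_div_cancel_right₀ _ hγ.ne']
  rw [h2, Real.exp_neg]
  gcongr
  linarith [Real.quadratic_le_exp_of_nonneg (zero_le_two (α := ℝ))]

theorem theorem5p4 (φ : ℝ → ℂ) (hφ : IsTypeII φ) :
    (∀ α : ℝ, 0 < α →
      Tendsto (fun γ : ℝ => bernsteinM (dilate φ γ) (1 / α)) (𝓝[>] 0)
        (𝓝 (ENNReal.ofReal (α ^ 2 / 4)))) ∧
    (∀ p : ℝ, 0 < p → p < 1 → ∃ c : ℝ, 0 < c ∧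
      ∀ α β : ℝ, 0 < α → 0 < β → α * β = p →
        IsGaborFrame (dilate φ (c * β)) α β) :=
  ⟨fun _ hα => tendsto_bernsteinM hφ hα, fun _ hp hp1 => exists_isGaborFrame_dilate hφ hp hp1⟩

end
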